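/- Let $\Sigma_0$ be a minimal port-Hamiltonian system $\dot x=Ax+Bv$, $z=Cx$ with state in $\mathbb R^n$, $A=(J-R)Q$, $C=B^{\mathsf T}Q$, where $J=-J^{\mathsf T}$, $R=R^{\mathsf T}\succcurlyeq0$ and $Q=Q^{\mathsf T}\succ0$. Consider $\bar n$ copies of $\Sigma_0$ coupled by $$v_i=\sum_{j\neq i}w_{ij}(z_j-z_i)+\sum_{j}g_{ij}u_j,\qquad y_i=\sum_j h_{ij}z_j,$$ with weights $w_{ij}\ge 0$, and let $G=(g_{ij})$, $H=(h_{ij})$. Let $\mathcal G$ be the directed graph on $\{1,\dots,\bar n\}$ with an arc $(i,j)$, $i\ne j$, iff $w_{ji}>0$, and let $\mathcal G_u$ be the undirected graph with an edge $\{i,j\}$, $i\neq j$, iff $w_{ij}+w_{ji}>0$. Assume that $\mathcal G_u$ is a tree and that $\mathcal G$ contains a directed rooted spanning tree as a subgraph (a directed tree on all vertices in which every vertex has exactly one incoming arc, except a single root, which has none). Number and orient the edges of $\mathcal G_u$ arbitrarily. Let $E$ be the oriented incidence matrix, whose column for the edge $(i,j)$ is $e_i-e_j$, let $F$ be the matrix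 whose corresponding column is $w_{ij}e_i-w_{ji}e_j$, and let $L_e=E^{\mathsf T}F$ be the edge Laplacian. The edge system is $$\dot x_e=(I\otimes A-L_e\otimes BC)x_e+(E^{\mathsf T}G\otimes B)u,\qquad y_e=(HFL_e^{-1}\otimes C)x_e,$$ and the dual edge system is $$\dot x_f=(I\otimes A-L_e\otimes BC)x_f+(L_e^{-1}E^{\mathsf T}G\otimes B)u,\qquad y_e=(HF\otimes C)x_f.$$ The edge controllability Gramian $\bar P_e$ is the controllability Gramian $\int_0^\infty e^{\mathcal A t}\mathcal B\mathcal B^{\mathsf T}e^{\mathcal A^{\mathsf T}t}\,dt$ of the edge system, and the edge observability Gramian $\bar Q_f$ is the observability Gramian $\int_0^\infty e^{\mathcal A^{\mathsf T}t}\mathcal C^{\mathsf T}\mathcal C e^{\mathcal A t}\,dt$ of the dual edge system, where $(\mathcal A,\mathcal B,\mathcal C)$ are the matrices of the respective system. Then the following hold. 1. If $\Pi^{c}\succcurlyeq0$ is diagonal and $L_e\Pi^{c}+\Pi^{c}L_e^{\mathsf T}-E^{\mathsf T}GG^{\mathsf T}E\succcurlyeq0$, then the integral defining $\bar P_e$ converges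 and $\bar P_e\preccurlyeq\Pi^{c}\otimes Q^{-1}$. 2. If $\Pi^{o}\succcurlyeq0$ is diagonal and $L_e^{\mathsf T}\Pi^{o}+\Pi^{o}L_e-F^{\mathsf T}H^{\mathsf T}HF\succcurlyeq0$, then the integral defining $\bar Q_f$ converges and $\bar Q_f\preccurlyeq\Pi^{o}\otimes Q$. -/

import Mathlib

open scoped Matrix Kronecker

/-! ### Linear time-invariant systems and their Gramians -/

/-- The system `ẋ = A x + B u`, `y = C x`, with state, input and output spaces `ℝˢ`, `ℝᵐ`, `ℝᵖ`. -/
structure LTISystem (s m p : Type*) where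
  A : Matrix s s ℝ
  B : Matrix s m ℝ
  C : Matrix p s ℝ

namespace LTISystem

variable {s m p : Type*} [Fintype s] [DecidableEq s]

/-- The impulse response `t ↦ C e^{tA} B`. -/
noncomputable def impulseResponse (S : LTISystem s m p) (t : ℝ) : Matrix p m ℝ :=
  S.C * NormedSpace.exp (t • S.A) * S.B

/-- A realization is minimal if no system with the same impulse response (that is, the same
input-output behaviour) has a state space of smaller dimension. -/
def IsMinimal (S : LTISystem s m p) : Prop :=
  ∀ (k : ℕ) (S' : LTISystem (Fin k) m p),
    (∀ t : ℝ, 0 ≤ t → S'.impulseResponse t = S.impulseResponse t) → Fintype.card s ≤ k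

/-- The integrand `e^{tA} B Bᵀ e^{tAᵀ}` of the controllability Gramian. -/
noncomputable def ctrlIntegrand [Fintype m] (S : LTISystem s m p) (t : ℝ) : Matrix s s ℝ :=
  NormedSpace.exp (t • S.A) * S.B * S.Bᵀ * NormedSpace.exp (t • S.Aᵀ)

/-- The integrand `e^{tAᵀ} Cᵀ C e^{tA}` of the observability Gramian. -/
noncomputable def obsIntegrand [Fintype p] (S : LTISystem s m p) (t : ℝ) : Matrix s s ℝ :=
  NormedSpace.exp (t • S.Aᵀ) * S.Cᵀ * S.C * NormedSpace.exp (t • S.A)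

/-- The (infinite-horizon) controllability Gramian `∫₀^∞ e^{tA} B Bᵀ e^{tAᵀ} dt`. -/
noncomputable def controllabilityGramian [Fintype m] (S : LTISystem s m p) : Matrix s s ℝ :=
  Matrix.of fun i j => ∫ t in Set.Ioi (0 : ℝ), S.ctrlIntegrand t i j

/-- Convergence of the integral that defines the controllability Gramian. -/
def HasControllabilityGramian [Fintype m] (S : LTISystem s m p) : Prop :=
  ∀ i j, MeasureTheory.IntegrableOn (fun t => S.ctrlIntegrand t i j) (Set.Ioi (0 : ℝ))

/-- The (infinite-horizon) observability Gramian `∫₀^∞ e^{tAᵀ} Cᵀ C e^{tA} dt`. -/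
noncomputable def observabilityGramian [Fintype p] (S : LTISystem s m p) : Matrix s s ℝ :=
  Matrix.of fun i j => ∫ t in Set.Ioi (0 : ℝ), S.obsIntegrand t i j

/-- Convergence of the integral that defines the observability Gramian. -/
def HasObservabilityGramian [Fintype p] (S : LTISystem s m p) : Prop :=
  ∀ i j, MeasureTheory.IntegrableOn (fun t => S.obsIntegrand t i j) (Set.Ioi (0 : ℝ))

end LTISystem

/-! ### Passive subsystems in port-Hamiltonian form -/

/-- A minimal port-Hamiltonian system `ẋ = (J - R) Q x + B v`, `z = Bᵀ Q x`. -/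
structure PortHamiltonian (n m : Type*) [Fintype n] [DecidableEq n] where
  J : Matrix n n ℝ
  R : Matrix n n ℝ
  Q : Matrix n n ℝ
  B : Matrix n m ℝ
  J_skew : Jᵀ = -J
  R_psd : R.PosSemidef
  Q_pd : Q.PosDef
  minimal : (LTISystem.mk ((J - R) * Q) B (Bᵀ * Q)).IsMinimal

namespace PortHamiltonian

variable {n m : Type*} [Fintype n] [DecidableEq n]

def A (S : PortHamiltonian n m) : Matrix n n ℝ := (S.J - S.R) * S.Q

def C (S : PortHamiltonian n m) : Matrix m n ℝ := S.Bᵀ * S.Q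

end PortHamiltonian

/-! ### Networks of identical subsystems -/

/-- Identical subsystems at the vertices `V`, coupled by
`v_i = ∑_{j ≠ i} w_ij (z_j - z_i) + ∑_j G_ij u_j`, with outputs `y_i = ∑_j H_ij z_j`. -/
structure Network (V n m U Y : Type*) [Fintype n] [DecidableEq n] where
  sub : PortHamiltonian n m
  w : V → V → ℝ
  w_nonneg : ∀ i j, 0 ≤ w i j
  G : Matrix V U ℝ
  H : Matrix Y V ℝ

/-- A directed rooted spanning tree on `V`: a directed tree connecting all vertices, in which every
vertex has exactly one incoming arc, except for a single root, which has none. -/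
def Digraph.IsDirectedRootedSpanningTree {V : Type*} (T : Digraph V) : Prop :=
  T.toSimpleGraphInclusive.IsTree ∧
    ∃ r : V, (∀ u, ¬ T.Adj u r) ∧ ∀ v, v ≠ r → ∃! u, T.Adj u v

/-- A numbering of the edges of `𝒢` by `ι`, together with an orientation: the edge numbered `l`
joins `fst l` and `snd l`. -/
structure EdgeOrientation {V : Type*} (𝒢 : SimpleGraph V) (ι : Type*) where
  edge : ι ≃ 𝒢.edgeSet
  fst : ι → V
  snd : ι → V
  edge_eq : ∀ l, (edge l : Sym2 V) = s(fst l, snd l)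

namespace Network

variable {V n m U Y ι : Type*} [Fintype V] [DecidableEq V] [Fintype n] [DecidableEq n]
  [Fintype m] [Fintype U] [Fintype Y] [Fintype ι] [DecidableEq ι]

/-- The Laplacian: `-w_ij` off the diagonal, `∑_{j ≠ i} w_ij` on the diagonal. -/
def laplacian (N : Network V n m U Y) : Matrix V V ℝ :=
  Matrix.of fun i j => if i = j then ∑ k ∈ Finset.univ.erase i, N.w i k else -N.w i j

/-- The networked system `ẋ = (I ⊗ A - L ⊗ BC) x + (G ⊗ B) u`, `y = (H ⊗ C) x`. -/
def toLTISystem (N : Network V n m U Y) : LTISystem (V × n) (U × m) (Y × m) where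
  A := (1 : Matrix V V ℝ) ⊗ₖ N.sub.A - N.laplacian ⊗ₖ (N.sub.B * N.sub.C)
  B := N.G ⊗ₖ N.sub.B
  C := N.H ⊗ₖ N.sub.C

/-- The directed graph of the network: `(i, j)` is an arc iff `w_ji > 0` (the weights `w_ii` do not
enter the coupling and give no loops). -/
def digraph (N : Network V n m U Y) : Digraph V where
  Adj i j := i ≠ j ∧ 0 < N.w j i

/-- The underlying undirected graph: `i` and `j` are adjacent iff `w_ij + w_ji > 0`. -/
def underlyingGraph (N : Network V n m U Y) : SimpleGraph V where
  Adj i j := i ≠ j ∧ 0 < N.w i j + N.w j i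
  symm := ⟨fun _ _ h => ⟨h.1.symm, by rw [add_comm]; exact h.2⟩⟩
  loopless := ⟨fun _ h => h.1 rfl⟩

/-- The underlying undirected graph is a tree, and the directed graph contains a directed rooted
spanning tree as a subgraph. -/
structure TreeAssumption (N : Network V n m U Y) : Prop where
  isTree : N.underlyingGraph.IsTree
  hasSpanningTree : ∃ T : Digraph V, T ≤ N.digraph ∧ T.IsDirectedRootedSpanningTree

/-- The oriented incidence matrix `E`: the column of the edge `l = (i, j)` is `e_i - e_j`. -/
def incE (N : Network V n m U Y) (o : EdgeOrientation N.underlyingGraph ι) : Matrix V ι ℝ :=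
  Matrix.of fun v l =>
    (Pi.single (o.fst l) (1 : ℝ) - Pi.single (o.snd l) (1 : ℝ) : V → ℝ) v

/-- The weighted matrix `F`: the column of the edge `l = (i, j)` is `w_ij e_i - w_ji e_j`. -/
def incF (N : Network V n m U Y) (o : EdgeOrientation N.underlyingGraph ι) : Matrix V ι ℝ :=
  Matrix.of fun v l =>
    (Pi.single (o.fst l) (N.w (o.fst l) (o.snd l))
      - Pi.single (o.snd l) (N.w (o.snd l) (o.fst l)) : V → ℝ) v

/-- The edge Laplacian `L_e = Eᵀ F`. -/
def edgeLaplacian (N : Network V n m U Y) (o : EdgeOrientation N.underlyingGraph ι) :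
    Matrix ι ι ℝ :=
  (N.incE o)ᵀ * N.incF o

/-- The edge system, with `G_e = Eᵀ G` and `H_e = H F (Eᵀ F)⁻¹`. -/
noncomputable def edgeSystem (N : Network V n m U Y) (o : EdgeOrientation N.underlyingGraph ι) :
    LTISystem (ι × n) (U × m) (Y × m) where
  A := (1 : Matrix ι ι ℝ) ⊗ₖ N.sub.A - N.edgeLaplacian o ⊗ₖ (N.sub.B * N.sub.C)
  B := ((N.incE o)ᵀ * N.G) ⊗ₖ N.sub.B
  C := (N.H * N.incF o * (N.edgeLaplacian o)⁻¹) ⊗ₖ N.sub.C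

/-- The dual edge system, with `G_f = (Eᵀ F)⁻¹ Eᵀ G` and `H_f = H F`. -/
noncomputable def dualEdgeSystem (N : Network V n m U Y)
    (o : EdgeOrientation N.underlyingGraph ι) :
    LTISystem (ι × n) (U × m) (Y × m) where
  A := (1 : Matrix ι ι ℝ) ⊗ₖ N.sub.A - N.edgeLaplacian o ⊗ₖ (N.sub.B * N.sub.C)
  B := ((N.edgeLaplacian o)⁻¹ * ((N.incE o)ᵀ * N.G)) ⊗ₖ N.sub.B
  C := (N.H * N.incF o) ⊗ₖ N.sub.C

/-- `piC ⊗ Q⁻¹` is a generalized edge controllability Gramian: `piC` is diagonal, `piC ≽ 0` and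
`L_e piC + piC L_eᵀ - Eᵀ G Gᵀ E ≽ 0`. -/
structure IsGenEdgeControllability (N : Network V n m U Y)
    (o : EdgeOrientation N.underlyingGraph ι) (piC : Matrix ι ι ℝ) : Prop where
  isDiag : piC.IsDiag
  psd : piC.PosSemidef
  lmi : (N.edgeLaplacian o * piC + piC * (N.edgeLaplacian o)ᵀ
    - (N.incE o)ᵀ * N.G * N.Gᵀ * N.incE o).PosSemidef

/-- `piO ⊗ Q` is a generalized edge observability Gramian: `piO` is diagonal, `piO ≽ 0` and
`L_eᵀ piO + piO L_e - Fᵀ Hᵀ H F ≽ 0`. -/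
structure IsGenEdgeObservability (N : Network V n m U Y)
    (o : EdgeOrientation N.underlyingGraph ι) (piO : Matrix ι ι ℝ) : Prop where
  isDiag : piO.IsDiag
  psd : piO.PosSemidef
  lmi : ((N.edgeLaplacian o)ᵀ * piO + piO * N.edgeLaplacian o
    - (N.incF o)ᵀ * N.Hᵀ * N.H * N.incF o).PosSemidef

/-- The edge controllability Gramian: the controllability Gramian of the edge system. -/
noncomputable def edgeControllabilityGramian (N : Network V n m U Y)
    (o : EdgeOrientation N.underlyingGraph ι) : Matrix (ι × n) (ι × n) ℝ :=
  (N.edgeSystem o).controllabilityGramian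

/-- The edge observability Gramian: the observability Gramian of the dual edge system. -/
noncomputable def edgeObservabilityGramian (N : Network V n m U Y)
    (o : EdgeOrientation N.underlyingGraph ι) : Matrix (ι × n) (ι × n) ℝ :=
  (N.dualEdgeSystem o).observabilityGramian

end Network

/-! If `X ≽ 0` and `A X + X Aᵀ + B Bᵀ ≼ 0`, then the derivative of `e^{tA} X e^{tAᵀ}` is at most
minus the Gramian integrand. Integrating over `[0, T]` bounds the finite-horizon Gramian by `X -
e^{TA} X e^{TAᵀ} ≼ X`. The integrand is positive semidefinite, so this uniform bound gives both
convergence and, as `T → ∞`, domination by `X`; no stability is presupposed.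

It remains to see that `Π ⊗ Q⁻¹` satisfies this inequality for the edge system. Since `A Q⁻¹ = J -
R` and `C Q⁻¹ = Bᵀ`, the skew part `J` cancels and the slack is `Π ⊗ 2R` plus the slack of the edge
inequality tensored with `B Bᵀ` (`kronecker_ctrl_lyapunov`). Observability is controllability of the
dual system, with slack `Π ⊗ 2QRQ` plus a term tensored with `Cᵀ C` (`kronecker_obs_lyapunov`). -/

namespace Matrix

/-! ### Quadratic forms of `e^{tA} X e^{tAᵀ}` -/

section ExpDeriv

variable {s : Type*} [Fintype s] [DecidableEq s]

-- Differentiating the exponential needs some algebra norm; the choice is immaterial, as the results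
-- concern scalar functions.
attribute [local instance] Matrix.linftyOpNormedRing Matrix.linftyOpNormedAlgebra

theorem hasDerivAt_dotProduct_exp_conj_mulVec (A X : Matrix s s ℝ) (v : s → ℝ) (t : ℝ) :
    HasDerivAt
      (fun t : ℝ => v ⬝ᵥ (NormedSpace.exp (t • A) * X * NormedSpace.exp (t • Aᵀ)) *ᵥ v)
      (v ⬝ᵥ (NormedSpace.exp (t • A) * (A * X + X * Aᵀ) * NormedSpace.exp (t • Aᵀ)) *ᵥ v) t := by
  -- The two forms of the derivative put `A` to the right of its exponential and `Aᵀ` to the left of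
  -- its own, so both land next to `X`.
  have h := ((hasDerivAt_exp_smul_const (𝕂 := ℝ) A t).mul_const X).mul
    (hasDerivAt_exp_smul_const' (𝕂 := ℝ) Aᵀ t)
  let φ : Matrix s s ℝ →ₗ[ℝ] ℝ :=
    { toFun := fun M => v ⬝ᵥ M *ᵥ v
      map_add' := fun M M' => by simp [Matrix.add_mulVec, dotProduct_add]
      map_smul' := fun c M => by simp [Matrix.smul_mulVec, dotProduct_smul] }
  have h' := (LinearMap.toContinuousLinearMap φ).hasFDerivAt.comp_hasDerivAt t h
  refine h'.congr_deriv ?_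
  change v ⬝ᵥ _ *ᵥ v = _
  congr 2
  simp only [mul_add, add_mul, mul_assoc]
  rfl

theorem continuous_dotProduct_exp_conj_mulVec (A X : Matrix s s ℝ) (v : s → ℝ) :
    Continuous
      (fun t : ℝ => v ⬝ᵥ (NormedSpace.exp (t • A) * X * NormedSpace.exp (t • Aᵀ)) *ᵥ v) :=
  continuous_iff_continuousAt.2 fun t =>
    (hasDerivAt_dotProduct_exp_conj_mulVec A X v t).continuousAt

end ExpDeriv

section PosSemidef

variable {s : Type*} [Fintype s] [DecidableEq s]

theorem PosSemidef.dotProduct_exp_conj_mulVec_nonneg {X : Matrix s s ℝ} (hX : X.PosSemidef)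
    (A : Matrix s s ℝ) (v : s → ℝ) (t : ℝ) :
    0 ≤ v ⬝ᵥ (NormedSpace.exp (t • A) * X * NormedSpace.exp (t • Aᵀ)) *ᵥ v := by
  have h := hX.mul_mul_conjTranspose_same (NormedSpace.exp (t • A))
  rw [Matrix.conjTranspose_eq_transpose_of_trivial, ← Matrix.exp_transpose,
    Matrix.transpose_smul] at h
  simpa using h.dotProduct_mulVec_nonneg v

/-- Transfers integrability from quadratic forms, where signs are available, to the entries in which
the Gramian is defined. -/
theorem IsHermitian.apply_eq_polarization {M : Matrix s s ℝ} (hM : M.IsHermitian) (i j : s) :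
    M i j = 2⁻¹ * ((Pi.single i 1 + Pi.single j 1) ⬝ᵥ M *ᵥ (Pi.single i 1 + Pi.single j 1)
      - Pi.single i 1 ⬝ᵥ M *ᵥ Pi.single i 1 - Pi.single j 1 ⬝ᵥ M *ᵥ Pi.single j 1) := by
  have h : M j i = M i j := by simpa using hM.apply i j
  simp only [Matrix.mulVec_add, dotProduct_add, add_dotProduct, single_one_dotProduct,
    Matrix.mulVec_single_one, Matrix.col_apply, h]
  ring

end PosSemidef

end Matrix

/-! ### Lyapunov inequalities and Gramians -/

namespace LTISystem

open MeasureTheory Filter Topology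

variable {s m p : Type*} [Fintype s] [DecidableEq s]

section Controllability

variable [Fintype m] (S : LTISystem s m p)

theorem ctrlIntegrand_eq (t : ℝ) :
    S.ctrlIntegrand t
      = NormedSpace.exp (t • S.A) * (S.B * S.Bᵀ) * NormedSpace.exp (t • S.Aᵀ) := by
  rw [ctrlIntegrand, Matrix.mul_assoc _ S.B]

theorem ctrlIntegrand_isHermitian (t : ℝ) : (S.ctrlIntegrand t).IsHermitian := by
  rw [Matrix.IsHermitian, Matrix.conjTranspose_eq_transpose_of_trivial, ctrlIntegrand_eq]
  simp [Matrix.transpose_mul, ← Matrix.exp_transpose, Matrix.mul_assoc]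

theorem continuous_dotProduct_ctrlIntegrand_mulVec (v : s → ℝ) :
    Continuous fun t => v ⬝ᵥ S.ctrlIntegrand t *ᵥ v := by
  simpa only [ctrlIntegrand_eq] using
    Matrix.continuous_dotProduct_exp_conj_mulVec S.A (S.B * S.Bᵀ) v

theorem dotProduct_ctrlIntegrand_mulVec_nonneg (v : s → ℝ) (t : ℝ) :
    0 ≤ v ⬝ᵥ S.ctrlIntegrand t *ᵥ v := by
  rw [ctrlIntegrand_eq]
  exact (Matrix.posSemidef_self_mul_conjTranspose S.B).dotProduct_exp_conj_mulVec_nonneg S.A v t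

variable {S}

/-- A generalized controllability Gramian bounds the finite-horizon Gramians. -/
theorem intervalIntegral_ctrlIntegrand_le {X : Matrix s s ℝ} (hX : X.PosSemidef)
    (hlyap : (-(S.A * X + X * S.Aᵀ) - S.B * S.Bᵀ).PosSemidef) (v : s → ℝ) {T : ℝ} (hT : 0 ≤ T) :
    ∫ t in (0 : ℝ)..T, v ⬝ᵥ S.ctrlIntegrand t *ᵥ v ≤ v ⬝ᵥ X *ᵥ v := by
  have hcont := Matrix.continuous_dotProduct_exp_conj_mulVec S.A (S.A * X + X * S.Aᵀ) v
  have hftc := intervalIntegral.integral_eq_sub_of_hasDerivAt (a := 0) (b := T)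
    (fun t _ => Matrix.hasDerivAt_dotProduct_exp_conj_mulVec S.A X v t)
    (hcont.intervalIntegrable _ _)
  have hle : ∫ t in (0 : ℝ)..T, v ⬝ᵥ S.ctrlIntegrand t *ᵥ v
      ≤ ∫ t in (0 : ℝ)..T, -(v ⬝ᵥ (NormedSpace.exp (t • S.A) * (S.A * X + X * S.Aᵀ)
        * NormedSpace.exp (t • S.Aᵀ)) *ᵥ v) := by
    refine intervalIntegral.integral_mono_on hT
      ((S.continuous_dotProduct_ctrlIntegrand_mulVec v).intervalIntegrable _ _)
      (hcont.neg.intervalIntegrable _ _) fun t _ => ?_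
    have h := hlyap.dotProduct_exp_conj_mulVec_nonneg S.A v t
    rw [Matrix.mul_sub, Matrix.sub_mul, ← ctrlIntegrand_eq, Matrix.mul_neg, Matrix.neg_mul,
      Matrix.sub_mulVec, Matrix.neg_mulVec, dotProduct_sub, dotProduct_neg] at h
    linarith
  rw [intervalIntegral.integral_neg, hftc] at hle
  -- The endpoint term at `T` enters with a minus sign and is dropped.
  have h := hX.dotProduct_exp_conj_mulVec_nonneg S.A v T
  simp only [zero_smul, NormedSpace.exp_zero, Matrix.one_mul, Matrix.mul_one] at hle
  linarith

/-- A nonnegative integrand equals its norm, so bounded integrals over `[0, T]` suffice. -/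
theorem integrableOn_dotProduct_ctrlIntegrand_mulVec {X : Matrix s s ℝ} (hX : X.PosSemidef)
    (hlyap : (-(S.A * X + X * S.Aᵀ) - S.B * S.Bᵀ).PosSemidef) (v : s → ℝ) :
    IntegrableOn (fun t => v ⬝ᵥ S.ctrlIntegrand t *ᵥ v) (Set.Ioi 0) := by
  refine integrableOn_Ioi_of_intervalIntegral_norm_bounded (v ⬝ᵥ X *ᵥ v) 0
    (fun T : ℝ => (S.continuous_dotProduct_ctrlIntegrand_mulVec v).integrableOn_Ioc)
    tendsto_id ?_
  filter_upwards [eventually_ge_atTop 0] with T hT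
  simpa only [id_eq, Real.norm_of_nonneg (S.dotProduct_ctrlIntegrand_mulVec_nonneg v _)] using
    intervalIntegral_ctrlIntegrand_le hX hlyap v hT

/-- The controllability Gramian exists as soon as the system has a generalized one. -/
theorem hasControllabilityGramian_of_lyapunov {X : Matrix s s ℝ} (hX : X.PosSemidef)
    (hlyap : (-(S.A * X + X * S.Aᵀ) - S.B * S.Bᵀ).PosSemidef) :
    S.HasControllabilityGramian := by
  intro i j
  have h := integrableOn_dotProduct_ctrlIntegrand_mulVec hX hlyap
  simp only [fun t => (S.ctrlIntegrand_isHermitian t).apply_eq_polarization i j]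
  exact (((h _).sub (h _)).sub (h _)).const_mul _

theorem HasControllabilityGramian.dotProduct_mulVec (hS : S.HasControllabilityGramian)
    (v : s → ℝ) :
    v ⬝ᵥ S.controllabilityGramian *ᵥ v
      = ∫ t in Set.Ioi (0 : ℝ), v ⬝ᵥ S.ctrlIntegrand t *ᵥ v := by
  simp only [dotProduct, Matrix.mulVec, controllabilityGramian, Matrix.of_apply]
  rw [integral_finsetSum _ fun i _ =>
    (integrable_finsetSum _ fun j _ => (hS i j).mul_const _).const_mul _]
  refine Finset.sum_congr rfl fun i _ => ?_
  rw [integral_const_mul, integral_finsetSum _ fun j _ => (hS i j).mul_const _]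
  simp only [integral_mul_const]

theorem controllabilityGramian_isHermitian : S.controllabilityGramian.IsHermitian := by
  ext i j
  simp only [Matrix.conjTranspose_apply, controllabilityGramian, Matrix.of_apply, star_trivial]
  exact integral_congr_ae (.of_forall fun t => (S.ctrlIntegrand_isHermitian t).apply i j)

/-- Every generalized controllability Gramian dominates the controllability Gramian. -/
theorem posSemidef_sub_controllabilityGramian {X : Matrix s s ℝ} (hX : X.PosSemidef)
    (hlyap : (-(S.A * X + X * S.Aᵀ) - S.B * S.Bᵀ).PosSemidef) :
    (X - S.controllabilityGramian).PosSemidef := by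
  refine .of_dotProduct_mulVec_nonneg
    (hX.isHermitian.sub controllabilityGramian_isHermitian) fun v => ?_
  rw [star_trivial, Matrix.sub_mulVec, dotProduct_sub,
    (hasControllabilityGramian_of_lyapunov hX hlyap).dotProduct_mulVec, sub_nonneg]
  refine le_of_tendsto (intervalIntegral_tendsto_integral_Ioi 0
    (integrableOn_dotProduct_ctrlIntegrand_mulVec hX hlyap v) tendsto_id) ?_
  filter_upwards [eventually_ge_atTop 0] with T hT
  exact intervalIntegral_ctrlIntegrand_le hX hlyap v hT

end Controllability

/-- The dual system `ẋ = Aᵀ x + Cᵀ u`, `y = Bᵀ x`. -/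
def dual (S : LTISystem s m p) : LTISystem s p m := ⟨S.Aᵀ, S.Cᵀ, S.Bᵀ⟩

end LTISystem

/-! ### The port-Hamiltonian structure and Kronecker products -/

namespace PortHamiltonian

variable {n m ι κ : Type*} [Fintype n] [DecidableEq n] (S : PortHamiltonian n m)

theorem Q_transpose : S.Qᵀ = S.Q := by
  simpa [Matrix.conjTranspose_eq_transpose_of_trivial] using S.Q_pd.isHermitian.eq

theorem R_transpose : S.Rᵀ = S.R := by
  simpa [Matrix.conjTranspose_eq_transpose_of_trivial] using S.R_psd.isHermitian.eq

theorem A_mul_Q_inv : S.A * S.Q⁻¹ = S.J - S.R :=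
  Matrix.mul_nonsing_inv_cancel_right _ _ (S.Q.isUnit_iff_isUnit_det.1 S.Q_pd.isUnit)

theorem C_mul_Q_inv : S.C * S.Q⁻¹ = S.Bᵀ :=
  Matrix.mul_nonsing_inv_cancel_right _ _ (S.Q.isUnit_iff_isUnit_det.1 S.Q_pd.isUnit)

theorem Q_inv_mul_A_transpose : S.Q⁻¹ * S.Aᵀ = -S.J - S.R := by
  have h := congrArg Matrix.transpose S.A_mul_Q_inv
  rwa [Matrix.transpose_mul, Matrix.transpose_nonsing_inv, Q_transpose, Matrix.transpose_sub,
    S.J_skew, R_transpose] at h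

theorem Q_inv_mul_C_transpose : S.Q⁻¹ * S.Cᵀ = S.B := by
  have h := congrArg Matrix.transpose S.C_mul_Q_inv
  rwa [Matrix.transpose_mul, Matrix.transpose_nonsing_inv, Q_transpose,
    Matrix.transpose_transpose] at h

theorem C_transpose : S.Cᵀ = S.Q * S.B := by
  rw [C, Matrix.transpose_mul, Q_transpose, Matrix.transpose_transpose]

theorem A_transpose : S.Aᵀ = S.Q * (-S.J - S.R) := by
  rw [A, Matrix.transpose_mul, Q_transpose, Matrix.transpose_sub, S.J_skew, R_transpose]

variable [Fintype m] [Fintype ι] [DecidableEq ι] [Fintype κ]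

/-- Diffusive coupling of copies of a port-Hamiltonian system: a solution `P` of the coupling
inequality gives the generalized controllability Gramian `P ⊗ Q⁻¹`. -/
theorem kronecker_ctrl_lyapunov {L P : Matrix ι ι ℝ} {K : Matrix ι κ ℝ} (hP : P.PosSemidef)
    (hL : (L * P + P * Lᵀ - K * Kᵀ).PosSemidef) :
    (-(((1 : Matrix ι ι ℝ) ⊗ₖ S.A - L ⊗ₖ (S.B * S.C)) * (P ⊗ₖ S.Q⁻¹)
        + (P ⊗ₖ S.Q⁻¹) * ((1 : Matrix ι ι ℝ) ⊗ₖ S.A - L ⊗ₖ (S.B * S.C))ᵀ)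
      - (K ⊗ₖ S.B) * (K ⊗ₖ S.B)ᵀ).PosSemidef := by
  have h₁ := hP.kronecker (S.R_psd.add S.R_psd)
  have h₂ := hL.kronecker (Matrix.posSemidef_self_mul_conjTranspose S.B)
  refine Eq.subst (motive := Matrix.PosSemidef) ?_ (h₁.add h₂)
  simp only [Matrix.transpose_sub, ← Matrix.kroneckerMap_transpose, Matrix.sub_mul, Matrix.mul_sub,
    ← Matrix.mul_kronecker_mul, Matrix.transpose_one, Matrix.one_mul, Matrix.mul_one,
    Matrix.transpose_mul, ← Matrix.mul_assoc, A_mul_Q_inv, Q_inv_mul_A_transpose,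
    Q_inv_mul_C_transpose, Matrix.conjTranspose_eq_transpose_of_trivial]
  simp only [Matrix.mul_assoc, C_mul_Q_inv]
  -- Entrywise the identity is polynomial, and the two `J` terms cancel.
  ext ⟨i, a⟩ ⟨j, b⟩
  simp only [Matrix.kroneckerMap_apply, Matrix.add_apply, Matrix.sub_apply, Matrix.neg_apply]
  ring

/-- Diffusive coupling of copies of a port-Hamiltonian system: a solution `P` of the dual coupling
inequality gives the generalized observability Gramian `P ⊗ Q`. -/
theorem kronecker_obs_lyapunov {L P : Matrix ι ι ℝ} {K : Matrix κ ι ℝ} (hP : P.PosSemidef)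
    (hL : (Lᵀ * P + P * L - Kᵀ * K).PosSemidef) :
    (-(((1 : Matrix ι ι ℝ) ⊗ₖ S.A - L ⊗ₖ (S.B * S.C))ᵀ * (P ⊗ₖ S.Q)
        + (P ⊗ₖ S.Q) * ((1 : Matrix ι ι ℝ) ⊗ₖ S.A - L ⊗ₖ (S.B * S.C)))
      - (K ⊗ₖ S.C)ᵀ * (K ⊗ₖ S.C)).PosSemidef := by
  have hR := S.R_psd.conjTranspose_mul_mul_same S.Q
  rw [Matrix.conjTranspose_eq_transpose_of_trivial, Q_transpose] at hR
  have h₁ := hP.kronecker (hR.add hR)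
  have h₂ := hL.kronecker (Matrix.posSemidef_conjTranspose_mul_self S.C)
  refine Eq.subst (motive := Matrix.PosSemidef) ?_ (h₁.add h₂)
  simp only [Matrix.transpose_sub, ← Matrix.kroneckerMap_transpose, Matrix.sub_mul, Matrix.mul_sub,
    ← Matrix.mul_kronecker_mul, Matrix.transpose_one, Matrix.one_mul, Matrix.mul_one,
    Matrix.transpose_mul, Matrix.conjTranspose_eq_transpose_of_trivial, C_transpose, A_transpose]
  simp only [A, C, Matrix.mul_assoc, Matrix.sub_mul, Matrix.mul_sub, Matrix.mul_neg,
    Matrix.neg_mul]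
  ext ⟨i, a⟩ ⟨j, b⟩
  simp only [Matrix.kroneckerMap_apply, Matrix.add_apply, Matrix.sub_apply, Matrix.neg_apply]
  ring

end PortHamiltonian

theorem mainTheorem3
    {V n m U Y ι : Type*} [Fintype V] [DecidableEq V] [Fintype n] [DecidableEq n]
    [Fintype m] [Fintype U] [Fintype Y] [Fintype ι] [DecidableEq ι]
    (N : Network V n m U Y) (hN : N.TreeAssumption)
    (o : EdgeOrientation N.underlyingGraph ι) :
    (∀ piC : Matrix ι ι ℝ, N.IsGenEdgeControllability o piC →
      (N.edgeSystem o).HasControllabilityGramian ∧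
      (piC ⊗ₖ N.sub.Q⁻¹ - N.edgeControllabilityGramian o).PosSemidef) ∧
    (∀ piO : Matrix ι ι ℝ, N.IsGenEdgeObservability o piO →
      (N.dualEdgeSystem o).HasObservabilityGramian ∧
      (piO ⊗ₖ N.sub.Q - N.edgeObservabilityGramian o).PosSemidef) := by
  refine ⟨fun piC h => ?_, fun piO h => ?_⟩
  · have hX : (piC ⊗ₖ N.sub.Q⁻¹).PosSemidef := h.psd.kronecker N.sub.Q_pd.inv.posSemidef
    have hL := h.lmi
    -- Regroups the input term as `K Kᵀ` with `K = Eᵀ G`.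
    rw [Matrix.mul_assoc, ← Matrix.transpose_transpose (N.incE o), ← Matrix.transpose_mul,
      Matrix.transpose_transpose] at hL
    have hlyap := N.sub.kronecker_ctrl_lyapunov h.psd hL
    exact ⟨LTISystem.hasControllabilityGramian_of_lyapunov (S := N.edgeSystem o) hX hlyap,
      LTISystem.posSemidef_sub_controllabilityGramian (S := N.edgeSystem o) hX hlyap⟩
  · have hX : (piO ⊗ₖ N.sub.Q).PosSemidef := h.psd.kronecker N.sub.Q_pd.posSemidef
    have hL := h.lmi
    rw [Matrix.mul_assoc, ← Matrix.transpose_mul] at hL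
    have hlyap := N.sub.kronecker_obs_lyapunov h.psd hL
    -- Double transposes reduce definitionally, so the observability integrand is the
    -- controllability integrand of the dual.
    exact ⟨LTISystem.hasControllabilityGramian_of_lyapunov (S := (N.dualEdgeSystem o).dual) hX hlyap,
      LTISystem.posSemidef_sub_controllabilityGramian (S := (N.dualEdgeSystem o).dual) hX hlyap⟩
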